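/- **Setting.** $\mathcal{EL}^+_\bot$ concepts over concept names $N_C$, role names $N_R$ and individual names $N_I$ are $A \mid \top \mid \bot \mid C\sqcap D \mid \exists r.C$, with the usual semantics over non-empty domains. A ranked knowledge base $K=\langle \mathcal T_{strict},\mathcal T_{C_1},\dots,\mathcal T_{C_k},\mathcal A\rangle$ over a finite set $\mathcal C=\{C_1,\dots,C_k\}$ of (distinguished) concepts consists of a finite set $\mathcal T_{strict}$ of inclusions $C\sqsubseteq D$ and $r_1\circ\dots\circ r_n\sqsubseteq r$, a finite ABox $\mathcal A$ of assertions $C(a)$, $r(a,b)$, and, for each $j$, a finite set $\mathcal T_{C_j}$ of pairs $(\mathbf T(C_j)\sqsubseteq D,\,l)$ of a typicality inclusion and its rank $l\in\mathbb N$. It is normalized if all strict inclusions have one of the forms $\top\sqsubseteq C$, $A\sqsubseteq\bot$, $A\sqsubseteq C$, $A\sqcap B\sqsubseteq C$, $\exists R.A\sqsubseteq C$, $A\sqsubseteq\exists R.B$, $R\sqsubseteq T$, $R\circ S\sqsubseteq T$, all assertions have the form $C(a)$ or $R(a,b)$, and all typicality inclusions have the form $\mathbf T(B)\sqsubseteq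 C$ with $B\in\mathcal C$, where $A,B,C$ are concept names (in particular $\mathcal C\subseteq N_C$). **Models.** In an interpretation $I$ with domain $\Delta$, $x$ satisfies $\mathbf T(C_j)\sqsubseteq D$ if $x\notin C_j^I$ or $x\in D^I$; let $n^l_j(x)$ be the number of inclusions of rank $l$ in $\mathcal T_{C_j}$ that $x$ satisfies. Put $x\le_{C_j}y$ if $n^l_j(x)=n^l_j(y)$ for all $l$, or there is $l$ with $n_j^l(x)>n_j^l(y)$ and $n_j^h(x)=n_j^h(y)$ for all $h>l$; and $x<_{C_j}y$ if $x\le_{C_j}y$ and not $y\le_{C_j}x$. Write $C_h\succ C_j$ if $\mathcal T_{strict}$ entails $C_h\sqsubseteq C_j$ but not $C_j\sqsubseteq C_h$. A (finite) cw$^m$-interpretation $\langle\Delta,<_{C_1},\dots,<_{C_k},<,\cdot^I\rangle$ is an interpretation with finite non-empty domain, irreflexive, transitive, modular and well-founded relations $<_{C_i}$ on $\Delta$ (with $x \le_{C_i} y$ meaning not $y<_{C_i}x$), and the relation $<$ given by: $x<y$ iff $x<_{C_i}y$ for some $C_i\in\mathcal C$, and for all $C_j\in\mathcal C$ either $x\le_{C_j}y$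 or there is $C_h\in\mathcal C$ with $C_h\succ C_j$ and $x<_{C_h}y$. It is a cw$^m$-model of $K$ if each $<_{C_j}$ is the relation defined above from $\mathcal T_{C_j}$ and $I$, and $I$ satisfies $\mathcal T_{strict}$ and $\mathcal A$. It is $\mathbf T$-compliant for $K$ if $I$ satisfies $\mathcal T_{strict}$ and, for every $C_h\in\mathcal C$ with $C_h^I\neq\emptyset$, some $x\in C_h^I$ satisfies all inclusions in $\mathcal T_{C_h}$. **Program.** For concept names $C,D$ let $\Pi(K,C,D)$ be the ASP program with the following rules. * Facts: $nom(a)$, $cls(A)$, $rol(R)$ for all $a\in N_I$, $A\in N_C$, $R\in N_R$; and for the elements of $K$: $C(a)\mapsto subClass(a,C)$; $R(a,b)\mapsto supEx(a,R,b,b)$; $\top\sqsubseteq C\mapsto top(C)$; $A\sqsubseteq\bot\mapsto bot(A)$; $A\sqsubseteq C\mapsto subClass(A,C)$; $A\sqcap B\sqsubseteq C\mapsto subConj(A,B,C)$; $\exists R.A\sqsubseteq C\mapsto subEx(R,A,C)$; $A\sqsubseteq\exists R.B\mapsto supEx(A,R,B,aux^{A\sqsubseteq\exists R.B})$; $R\sqsubseteq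 T\mapsto subRole(R,T)$; $R\circ S\sqsubseteq T\mapsto subRChain(R,S,T)$; $\mathbf T(C_i)\sqsubseteq B$ with rank $n$ $\mapsto subTyp(C_i,B,n)$; also $auxtc(aux_{C_i},C_i)$ for $C_i\in\mathcal C$; and $auxtc(aux_C,C)$, $nom(aux_C)$, $inst(aux_C,C)$. * $dcls(c)\leftarrow subTyp(c,d,n)$; $tprop(c,d)\leftarrow subTyp(c,d,n)$; $validrank(c,n)\leftarrow subTyp(c,d,n)$. * Materialization rules (Krötzsch): $inst(x,x)\leftarrow nom(x)$; $inst(x,z)\leftarrow top(z),inst(x,z')$; $inst(x,y)\leftarrow bot(z),inst(u,z),inst(x,z'),cls(y)$; $inst(x,z)\leftarrow subClass(y,z),inst(x,y)$; $inst(x,z)\leftarrow subConj(y_1,y_2,z),inst(x,y_1),inst(x,y_2)$; $inst(x,z)\leftarrow subEx(v,y,z),triple(x,v,x'),inst(x',y)$; $triple(x,v,x')\leftarrow supEx(y,v,z,x'),inst(x,y)$; $inst(x',z)\leftarrow supEx(y,v,z,x'),inst(x,y)$; $triple(x,w,x')\leftarrow subRole(v,w),triple(x,v,x')$; $triple(x,w,x'')\leftarrow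 subRChain(u,v,w),triple(x,u,x'),triple(x',v,x'')$; $inst(y,z)\leftarrow inst(x,y),nom(y),inst(x,z)$; $inst(x,z)\leftarrow inst(x,y),nom(y),inst(y,z)$; $triple(z,u,y)\leftarrow inst(x,y),nom(y),triple(z,u,x)$; and the constraint $\leftarrow bot(z),inst(x,z)$. * Subclass checking: the same rules except the constraint, with $inst(x,y)$, $triple(x,v,y)$ replaced by $inst\_sc(x,y,q)$, $triple\_sc(x,v,y,q)$ for an additional variable $q$ (with $cls(q)$ in the body of the first rule), and $inst\_sc(q,q,q)\leftarrow cls(q)$; and $morespec(c,d)\leftarrow dcls(c),dcls(d),inst\_sc(c,d,c),\mathit{not}\ inst\_sc(d,c,d)$. * (a) $\{inst(aux_C,d)\}\leftarrow dcls(c),inst(aux_C,c),tprop(c,d)$ (a choice rule); (b) $inst(y,c)\leftarrow auxtc(y,c),inst(x,c)$; (c) $typ(y,c)\leftarrow auxtc(y,c),inst(y,c)$; (d) $inst(y,d)\leftarrow subTyp(c,d,n),typ(y,c)$. **Proposition.** Let $K$ be a normalized ranked $\mathcal{EL}^+_\bot$ knowledge base over $\mathcal C$ and let $C\sqsubseteq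 D$ be a subsumption between concept names. 1. If there is an answer set $S$ of $\Pi(K,C,D)$ with $inst(aux_C,D)\notin S$, then there is a $\mathbf T$-compliant cw$^m$-model of $K$ that falsifies $C\sqsubseteq D$. 2. If $C\notin\mathcal C$ and there is a $\mathbf T$-compliant cw$^m$-model of $K$ that falsifies $C\sqsubseteq D$, then there is an answer set $S$ of $\Pi(K,C,D)$ with $inst(aux_C,D)\notin S$. (A distinguished concept is queried through a new concept name $A$ with $A\sqsubseteq C$ and $C\sqsubseteq A$ added to $K$.) -/

import Mathlib

universe u

namespace CWM

/-! ### The description logic EL+⊥ -/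

/-- Concepts of EL+⊥ over concept names `NC` and role names `NR`. -/
inductive Concept (NC NR : Type u) : Type u
  | name (A : NC)
  | top
  | bot
  | inter (C D : Concept NC NR)
  | ex (R : NR) (C : Concept NC NR)

/-- Strict inclusions: concept inclusions `C ⊑ D` and role inclusions `r ∘ r₁ ∘ … ∘ rₙ ⊑ s`
(the left-hand side is the nonempty chain `r :: rs`). -/
inductive Inclusion (NC NR : Type u) : Type u
  | sub (C D : Concept NC NR)
  | role (r : NR) (rs : List NR) (s : NR)

/-- ABox assertions `C(a)` and `R(a,b)`. -/
inductive Assertion (NC NR NI : Type u) : Type u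
  | inst (C : Concept NC NR) (a : NI)
  | rel (R : NR) (a b : NI)

/-- An interpretation function over the domain `Δ`. -/
structure Interp (NC NR NI Δ : Type u) where
  conc : NC → Set Δ
  role : NR → Δ → Δ → Prop
  ind : NI → Δ

namespace Interp

variable {NC NR NI Δ : Type u}

/-- The extension of a concept. -/
def ext (I : Interp NC NR NI Δ) : Concept NC NR → Set Δ
  | .name A => I.conc A
  | .top => Set.univ
  | .bot => ∅
  | .inter C D => I.ext C ∩ I.ext D
  | .ex R C => {x | ∃ y, I.role R x y ∧ y ∈ I.ext C}

/-- The composition of the interpretations of the roles of the nonempty chain `r :: rs`. -/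
def chain (I : Interp NC NR NI Δ) : NR → List NR → Δ → Δ → Prop
  | r, [] => I.role r
  | r, r' :: rs => fun x z => ∃ y, I.role r x y ∧ I.chain r' rs y z

/-- Satisfaction of a strict inclusion. -/
def SatIncl (I : Interp NC NR NI Δ) : Inclusion NC NR → Prop
  | .sub C D => I.ext C ⊆ I.ext D
  | .role r rs s => ∀ x y, I.chain r rs x y → I.role s x y

/-- Satisfaction of an assertion. -/
def SatAssert (I : Interp NC NR NI Δ) : Assertion NC NR NI → Prop
  | .inst C a => I.ind a ∈ I.ext C
  | .rel R a b => I.role R (I.ind a) (I.ind b)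

/-- The element `x` satisfies the typicality inclusion `T(C) ⊑ D` in `I`. -/
def SatTyp (I : Interp NC NR NI Δ) (C D : Concept NC NR) (x : Δ) : Prop :=
  x ∉ I.ext C ∨ x ∈ I.ext D

end Interp

/-! ### Ranked knowledge bases -/

/-- A ranked EL+⊥ knowledge base. `dist` is the finite set of distinguished concepts; for
`C ∈ dist`, the pair `(D, r) ∈ typ C` is the typicality inclusion `T(C) ⊑ D` with rank `r`
(the values of `typ` outside `dist` are never used). -/
structure RankedKB (NC NR NI : Type u) where
  strict : Finset (Inclusion NC NR)
  dist : Finset (Concept NC NR)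
  typ : Concept NC NR → Finset (Concept NC NR × ℕ)
  abox : Finset (Assertion NC NR NI)

section Semantics

variable {NC NR NI Δ : Type u}

/-- `I` satisfies all strict inclusions of `K`. -/
def Interp.SatStrict (I : Interp NC NR NI Δ) (K : RankedKB NC NR NI) : Prop :=
  ∀ α ∈ K.strict, I.SatIncl α

/-- `I` satisfies all assertions of `K`. -/
def Interp.SatABox (I : Interp NC NR NI Δ) (K : RankedKB NC NR NI) : Prop :=
  ∀ α ∈ K.abox, I.SatAssert α

/-- The strict inclusions of `K` entail `C ⊑ D`: it holds in every interpretation (with non-empty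
domain) that satisfies all of them. -/
def RankedKB.StrictEntails (K : RankedKB NC NR NI) (C D : Concept NC NR) : Prop :=
  ∀ (Δ : Type u) [Nonempty Δ] (I : Interp NC NR NI Δ), I.SatStrict K → I.ext C ⊆ I.ext D

/-- `C` is more specific than `D`. -/
def RankedKB.MoreSpecific (K : RankedKB NC NR NI) (C D : Concept NC NR) : Prop :=
  K.StrictEntails C D ∧ ¬ K.StrictEntails D C

open Classical in
/-- The number of typicality inclusions of rank `l` for `C` that are satisfied by `x` in `I`. -/
noncomputable def satCount (K : RankedKB NC NR NI) (I : Interp NC NR NI Δ)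
    (C : Concept NC NR) (l : ℕ) (x : Δ) : ℕ :=
  ((K.typ C).filter (fun p => p.2 = l ∧ I.SatTyp C p.1 x)).card

/-- The preference `x ≤_C y` induced by the ranked TBox of `C` in `I`. -/
def rankLE (K : RankedKB NC NR NI) (I : Interp NC NR NI Δ) (C : Concept NC NR) (x y : Δ) : Prop :=
  (∀ l, satCount K I C l x = satCount K I C l y) ∨
    ∃ l, satCount K I C l x > satCount K I C l y ∧
      ∀ h > l, satCount K I C h x = satCount K I C h y

/-- The strict preference `x <_C y` induced by the ranked TBox of `C` in `I`. -/
def rankLT (K : RankedKB NC NR NI) (I : Interp NC NR NI Δ) (C : Concept NC NR) (x y : Δ) : Prop :=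
  rankLE K I C x y ∧ ¬ rankLE K I C y x

/-- (Finite) concept-wise multipreference interpretations. As each `lt C` is modular, the total
preorder `x ≤_C y` that belongs to it is `¬ y <_C x`. -/
structure CwmInterp (K : RankedKB NC NR NI) where
  Dom : Type u
  nonempty : Nonempty Dom
  finite : Finite Dom
  I : Interp NC NR NI Dom
  lt : {C : Concept NC NR // C ∈ K.dist} → Dom → Dom → Prop
  lt_irrefl : ∀ C x, ¬ lt C x x
  lt_trans : ∀ C x y z, lt C x y → lt C y z → lt C x z
  lt_wf : ∀ C, WellFounded (lt C)
  lt_modular : ∀ C x y z, lt C x y → lt C x z ∨ lt C z y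
  glt : Dom → Dom → Prop
  glt_iff : ∀ x y, glt x y ↔
    (∃ C, lt C x y) ∧
      ∀ C, ¬ lt C y x ∨
        ∃ C' : {C : Concept NC NR // C ∈ K.dist}, K.MoreSpecific C'.1 C.1 ∧ lt C' x y

/-- cw^m-models of `K`. -/
structure CwmInterp.IsModel {K : RankedKB NC NR NI} (M : CwmInterp K) : Prop where
  lt_iff : ∀ C x y, M.lt C x y ↔ rankLT K M.I C.1 x y
  strict : M.I.SatStrict K
  abox : M.I.SatABox K

/-- T-compliant interpretations for `K`. -/
def Interp.TCompliant (I : Interp NC NR NI Δ) (K : RankedKB NC NR NI) : Prop :=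
  I.SatStrict K ∧
    ∀ C ∈ K.dist, (I.ext C).Nonempty → ∃ x ∈ I.ext C, ∀ p ∈ K.typ C, I.SatTyp C p.1 x

end Semantics

/-! ### Normal form -/

section Normal

variable {NC NR NI : Type u}

/-- Strict inclusions in normal form. -/
inductive Inclusion.IsNormal : Inclusion NC NR → Prop
  | top (C : NC) : IsNormal (.sub .top (.name C))
  | bot (A : NC) : IsNormal (.sub (.name A) .bot)
  | sub (A C : NC) : IsNormal (.sub (.name A) (.name C))
  | conj (A B C : NC) : IsNormal (.sub (.inter (.name A) (.name B)) (.name C))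
  | exL (R : NR) (A C : NC) : IsNormal (.sub (.ex R (.name A)) (.name C))
  | exR (A : NC) (R : NR) (B : NC) : IsNormal (.sub (.name A) (.ex R (.name B)))
  | role (R T : NR) : IsNormal (.role R [] T)
  | chain (R S T : NR) : IsNormal (.role R [S] T)

/-- Assertions in normal form. -/
inductive Assertion.IsNormal : Assertion NC NR NI → Prop
  | inst (C : NC) (a : NI) : IsNormal (.inst (.name C) a)
  | rel (R : NR) (a b : NI) : IsNormal (.rel R a b)

/-- Ranked knowledge bases in normal form; a typicality inclusion `T(C) ⊑ D` is in normal form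
when `C` and `D` are concept names. -/
structure RankedKB.IsNormal (K : RankedKB NC NR NI) : Prop where
  strict : ∀ α ∈ K.strict, α.IsNormal
  abox : ∀ α ∈ K.abox, α.IsNormal
  dist : ∀ C ∈ K.dist, ∃ A, C = .name A
  typ : ∀ C ∈ K.dist, ∀ p ∈ K.typ C, ∃ B, p.1 = .name B

end Normal

/-! ### Answer sets of ground programs with choice rules and constraints -/

/-- Rule heads: an atom `a`, a choice `{a}`, or empty (for constraints). -/
inductive Head (α : Type u) : Type u
  | atom (a : α)
  | choice (a : α)
  | falsum

/-- Ground rules `head ← pos, not neg`. -/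
structure Rule (α : Type u) : Type u where
  head : Head α
  pos : List α
  neg : List α

section AnswerSets

variable {α : Type u}

/-- `S` satisfies the head. -/
def Head.Holds (S : Set α) : Head α → Prop
  | .atom a => a ∈ S
  | .choice _ => True
  | .falsum => False

/-- `S` satisfies the rule. -/
def Rule.Satisfied (r : Rule α) (S : Set α) : Prop :=
  (∀ b ∈ r.pos, b ∈ S) → (∀ b ∈ r.neg, b ∉ S) → r.head.Holds S

/-- The reduct of `P` with respect to `S`, a set of definite rules `a ← body`: a rule with a
negated atom in `S` is dropped, negated atoms are deleted from the others, and a choice rule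
`{a} ← body` becomes `a ← body` if `a ∈ S` and is dropped otherwise. -/
def reduct (P : Set (Rule α)) (S : Set α) : Set (α × List α) :=
  {q | ∃ r ∈ P, (∀ b ∈ r.neg, b ∉ S) ∧ r.pos = q.2 ∧
    (r.head = .atom q.1 ∨ (r.head = .choice q.1 ∧ q.1 ∈ S))}

/-- `T` is a model of a set of definite rules. -/
def ClosedUnder (Q : Set (α × List α)) (T : Set α) : Prop :=
  ∀ q ∈ Q, (∀ b ∈ q.2, b ∈ T) → q.1 ∈ T

/-- `S` is an answer set of `P`: it satisfies all rules of `P` and is the least model of the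
reduct of `P` with respect to `S`. -/
def IsAnswerSet (P : Set (Rule α)) (S : Set α) : Prop :=
  (∀ r ∈ P, r.Satisfied S) ∧ IsLeast {T | ClosedUnder (reduct P S) T} S

end AnswerSets

/-! ### The program -/

/-- The constants of the program: individual, concept and role names, ranks, one auxiliary constant
`auxEx A R B` for each inclusion `A ⊑ ∃R.B`, and the auxiliary individual names `aux C`
(`aux_{C_i}` for the distinguished concepts and `aux_C` for the query). -/
inductive Const (NC NR NI : Type u) : Type u
  | ind (a : NI)
  | cls (A : NC)
  | rol (R : NR)
  | rank (n : ℕ)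
  | auxEx (A : NC) (R : NR) (B : NC)
  | aux (C : NC)

/-- Ground atoms over a set `κ` of constants. `instSc x y q` and `tripleSc x v y q` are the
predicates for subclass checking: they are `inst x y` and `triple x v y` derived under the
assumption that the class `q` has an instance, represented by the constant `q` itself. -/
inductive GAtom (κ : Type u) : Type u
  | nom (x : κ)
  | cls (x : κ)
  | rol (x : κ)
  | top (x : κ)
  | bot (x : κ)
  | subClass (x y : κ)
  | subConj (x y z : κ)
  | subEx (v y z : κ)
  | supEx (y v z x : κ)
  | subRole (v w : κ)
  | subRChain (v v' w : κ)
  | subTyp (c d n : κ)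
  | dcls (c : κ)
  | tprop (c d : κ)
  | validrank (c n : κ)
  | auxtc (x c : κ)
  | inst (x y : κ)
  | triple (x v y : κ)
  | instSc (x y q : κ)
  | tripleSc (x v y q : κ)
  | typ (x c : κ)
  | morespec (c d : κ)

section Program

variable {NC NR NI : Type u}

/-- Input translation of normalized strict inclusions. -/
inductive InclFact : Inclusion NC NR → GAtom (Const NC NR NI) → Prop
  | top (C : NC) : InclFact (.sub .top (.name C)) (.top (.cls C))
  | bot (A : NC) : InclFact (.sub (.name A) .bot) (.bot (.cls A))
  | sub (A C : NC) : InclFact (.sub (.name A) (.name C)) (.subClass (.cls A) (.cls C))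
  | conj (A B C : NC) :
      InclFact (.sub (.inter (.name A) (.name B)) (.name C))
        (.subConj (.cls A) (.cls B) (.cls C))
  | exL (R : NR) (A C : NC) :
      InclFact (.sub (.ex R (.name A)) (.name C)) (.subEx (.rol R) (.cls A) (.cls C))
  | exR (A : NC) (R : NR) (B : NC) :
      InclFact (.sub (.name A) (.ex R (.name B)))
        (.supEx (.cls A) (.rol R) (.cls B) (.auxEx A R B))
  | role (R T : NR) : InclFact (.role R [] T) (.subRole (.rol R) (.rol T))
  | chain (R S T : NR) : InclFact (.role R [S] T) (.subRChain (.rol R) (.rol S) (.rol T))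

/-- Input translation of normalized assertions. -/
inductive AssertFact : Assertion NC NR NI → GAtom (Const NC NR NI) → Prop
  | inst (C : NC) (a : NI) : AssertFact (.inst (.name C) a) (.subClass (.ind a) (.cls C))
  | rel (R : NR) (a b : NI) :
      AssertFact (.rel R a b) (.supEx (.ind a) (.rol R) (.ind b) (.ind b))

/-- The facts of the program for `K` and a query with left-hand side `C`. -/
inductive Fact (K : RankedKB NC NR NI) (C : NC) : GAtom (Const NC NR NI) → Prop
  | nom (a : NI) : Fact K C (.nom (.ind a))
  | cls (A : NC) : Fact K C (.cls (.cls A))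
  | rol (R : NR) : Fact K C (.rol (.rol R))
  | incl {α : Inclusion NC NR} {f : GAtom (Const NC NR NI)} (hα : α ∈ K.strict)
      (hf : InclFact α f) : Fact K C f
  | assertion {α : Assertion NC NR NI} {f : GAtom (Const NC NR NI)} (hα : α ∈ K.abox)
      (hf : AssertFact α f) : Fact K C f
  | subTyp {A B : NC} {n : ℕ} (hA : Concept.name A ∈ K.dist)
      (hB : (Concept.name B, n) ∈ K.typ (Concept.name A)) :
      Fact K C (.subTyp (.cls A) (.cls B) (.rank n))
  | auxtc {A : NC} (hA : Concept.name A ∈ K.dist) : Fact K C (.auxtc (.aux A) (.cls A))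
  | queryAuxtc : Fact K C (.auxtc (.aux C) (.cls C))
  | queryNom : Fact K C (.nom (.aux C))
  | queryInst : Fact K C (.inst (.aux C) (.cls C))

/-- The ground instances of the definite rules (without negation), `DefRule a body` standing for
`a ← body`. -/
inductive DefRule {κ : Type u} : GAtom κ → List (GAtom κ) → Prop
  -- distinguished concepts, typical properties and valid ranks
  | dcls (c d n : κ) : DefRule (.dcls c) [.subTyp c d n]
  | tprop (c d n : κ) : DefRule (.tprop c d) [.subTyp c d n]
  | validrank (c d n : κ) : DefRule (.validrank c n) [.subTyp c d n]
  -- instance checking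
  | r1 (x : κ) : DefRule (.inst x x) [.nom x]
  | r3 (x z z' : κ) : DefRule (.inst x z) [.top z, .inst x z']
  | r4 (x y z u z' : κ) : DefRule (.inst x y) [.bot z, .inst u z, .inst x z', .cls y]
  | r5 (x y z : κ) : DefRule (.inst x z) [.subClass y z, .inst x y]
  | r6 (x y₁ y₂ z : κ) : DefRule (.inst x z) [.subConj y₁ y₂ z, .inst x y₁, .inst x y₂]
  | r7 (x x' v y z : κ) : DefRule (.inst x z) [.subEx v y z, .triple x v x', .inst x' y]
  | r9 (x x' v y z : κ) : DefRule (.triple x v x') [.supEx y v z x', .inst x y]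
  | r10 (x x' v y z : κ) : DefRule (.inst x' z) [.supEx y v z x', .inst x y]
  | r13 (x x' v w : κ) : DefRule (.triple x w x') [.subRole v w, .triple x v x']
  | r15 (x x' x'' u v w : κ) :
      DefRule (.triple x w x'') [.subRChain u v w, .triple x u x', .triple x' v x'']
  | r27 (x y z : κ) : DefRule (.inst y z) [.inst x y, .nom y, .inst x z]
  | r28 (x y z : κ) : DefRule (.inst x z) [.inst x y, .nom y, .inst y z]
  | r29 (x y z u : κ) : DefRule (.triple z u y) [.inst x y, .nom y, .triple z u x]
  -- subclass checking: the same rules, relative to the assumption that `q` has an instance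
  | s0 (q : κ) : DefRule (.instSc q q q) [.cls q]
  | s1 (x q : κ) : DefRule (.instSc x x q) [.nom x, .cls q]
  | s3 (x z z' q : κ) : DefRule (.instSc x z q) [.top z, .instSc x z' q]
  | s4 (x y z u z' q : κ) :
      DefRule (.instSc x y q) [.bot z, .instSc u z q, .instSc x z' q, .cls y]
  | s5 (x y z q : κ) : DefRule (.instSc x z q) [.subClass y z, .instSc x y q]
  | s6 (x y₁ y₂ z q : κ) :
      DefRule (.instSc x z q) [.subConj y₁ y₂ z, .instSc x y₁ q, .instSc x y₂ q]
  | s7 (x x' v y z q : κ) :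
      DefRule (.instSc x z q) [.subEx v y z, .tripleSc x v x' q, .instSc x' y q]
  | s9 (x x' v y z q : κ) : DefRule (.tripleSc x v x' q) [.supEx y v z x', .instSc x y q]
  | s10 (x x' v y z q : κ) : DefRule (.instSc x' z q) [.supEx y v z x', .instSc x y q]
  | s13 (x x' v w q : κ) : DefRule (.tripleSc x w x' q) [.subRole v w, .tripleSc x v x' q]
  | s15 (x x' x'' u v w q : κ) :
      DefRule (.tripleSc x w x'' q) [.subRChain u v w, .tripleSc x u x' q, .tripleSc x' v x'' q]
  | s27 (x y z q : κ) : DefRule (.instSc y z q) [.instSc x y q, .nom y, .instSc x z q]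
  | s28 (x y z q : κ) : DefRule (.instSc x z q) [.instSc x y q, .nom y, .instSc y z q]
  | s29 (x y z u q : κ) : DefRule (.tripleSc z u y q) [.instSc x y q, .nom y, .tripleSc z u x q]
  -- typical instances of the distinguished concepts
  | rb (y c x : κ) : DefRule (.inst y c) [.auxtc y c, .inst x c]
  | rc (y c : κ) : DefRule (.typ y c) [.auxtc y c, .inst y c]
  | rd (y c d n : κ) : DefRule (.inst y d) [.subTyp c d n, .typ y c]

/-- The ground program for `K` and a query `C ⊑ D` between concept names (nothing in it depends on
`D`, since no further normalization of the query is needed). -/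
inductive InProgram (K : RankedKB NC NR NI) (C : NC) : Rule (GAtom (Const NC NR NI)) → Prop
  | fact {f : GAtom (Const NC NR NI)} (hf : Fact K C f) : InProgram K C ⟨.atom f, [], []⟩
  | defRule {a : GAtom (Const NC NR NI)} {body : List (GAtom (Const NC NR NI))}
      (h : DefRule a body) : InProgram K C ⟨.atom a, body, []⟩
  | bot (z x : Const NC NR NI) : InProgram K C ⟨.falsum, [.bot z, .inst x z], []⟩
  | morespec (c d : Const NC NR NI) :
      InProgram K C ⟨.atom (.morespec c d), [.dcls c, .dcls d, .instSc c d c], [.instSc d c d]⟩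
  | choice (c d : Const NC NR NI) :
      InProgram K C
        ⟨.choice (.inst (.aux C) d), [.dcls c, .inst (.aux C) c, .tprop c d], []⟩

/-- The ground program for `K` and a query `C ⊑ D`, as a set of rules. -/
def program (K : RankedKB NC NR NI) (C : NC) : Set (Rule (GAtom (Const NC NR NI))) :=
  {r | InProgram K C r}

end Program

end CWM

/-! For part 1, a set `S` satisfying all rules is turned into an interpretation. Its elements are
the constants with an `inst` atom in `S` that come from the knowledge base or the query; there are
finitely many of these. Concepts and roles are read off from `inst` and `triple`. Each
materialization rule is exactly what makes the matching axiom true, and the constraint gives the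
inclusions into bottom. Rules (b), (c), (d) turn the auxiliary constant of a non-empty distinguished
concept into a fully typical instance, whence T-compliance. The query constant lies in `C` but not
in `D`. The preferences carry no further choice: those induced by the ranks are strict modular
orders, and finiteness makes them well-founded (`exists_model_of_satisfied`).

For part 2, no choice is made: the candidate is the closure of the facts under the definite rules,
together with the `morespec` atoms, which feed no definite rule and no constraint. It is an answer
set once the constraint holds (`isAnswerSet_choiceFreeAnswerSet`). Given a model and an element `e`
in `C` but not in `D`, every constant is read as a set of elements, the query constant as `{e}`. The
atom `inst x y` then says that `x` is non-empty and contained in `y`, and `triple x R y` that `x` is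
non-empty and each of its elements has an `R`-successor in `y`. All rules preserve this reading
(`sound_defRule`). Hence no instance of an empty class is derived, and `e` not being in `D` blocks
the queried atom. -/

namespace CWM

/-! ### The lexicographic comparison of the counts of satisfied typicality inclusions -/

/-- `f` is above `g` at the largest index where they differ. -/
def LexAbove (f g : ℕ → ℕ) : Prop :=
  ∃ l, f l > g l ∧ ∀ h > l, f h = g h

theorem LexAbove.irrefl (f : ℕ → ℕ) : ¬ LexAbove f f := by
  rintro ⟨l, hl, -⟩
  exact lt_irrefl _ hl

theorem LexAbove.trans {f g h : ℕ → ℕ} : LexAbove f g → LexAbove g h → LexAbove f h := by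
  rintro ⟨l, hl, hl'⟩ ⟨m, hm, hm'⟩
  rcases lt_trichotomy l m with hlm | rfl | hlm
  · exact ⟨m, by rw [hl' m hlm]; exact hm, fun k hk => (hl' k (hlm.trans hk)).trans (hm' k hk)⟩
  · exact ⟨l, hm.trans hl, fun k hk => (hl' k hk).trans (hm' k hk)⟩
  · exact ⟨l, by rw [← hm' l hlm]; exact hl, fun k hk => (hl' k hk).trans (hm' k (hlm.trans hk))⟩

theorem LexAbove.trichotomy {f g : ℕ → ℕ} {N : ℕ} (h : ∀ l > N, f l = g l) :
    f = g ∨ LexAbove f g ∨ LexAbove g f := by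
  induction N with
  | zero =>
    rcases lt_trichotomy (f 0) (g 0) with h0 | h0 | h0
    · exact Or.inr (Or.inr ⟨0, h0, fun l hl => (h l hl).symm⟩)
    · refine Or.inl (funext fun l => ?_)
      rcases Nat.eq_zero_or_pos l with rfl | hl
      exacts [h0, h l hl]
    · exact Or.inr (Or.inl ⟨0, h0, h⟩)
  | succ N ih =>
    rcases lt_trichotomy (f (N + 1)) (g (N + 1)) with h0 | h0 | h0
    · exact Or.inr (Or.inr ⟨N + 1, h0, fun l hl => (h l hl).symm⟩)
    · refine ih fun l hl => ?_
      rcases Nat.eq_or_lt_of_le (Nat.succ_le_of_lt hl) with rfl | hl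
      exacts [h0, h l hl]
    · exact Or.inr (Or.inl ⟨N + 1, h0, h⟩)

/-! ### Rank-induced preferences as strict modular orders -/

section Rank

variable {NC NR NI Δ : Type u} (K : RankedKB NC NR NI) (I : Interp NC NR NI Δ)
  (C : Concept NC NR)

theorem exists_satCount_eq_zero : ∃ N, ∀ l > N, ∀ x, satCount K I C l x = 0 := by
  -- Beyond the largest rank occurring for `C` there is nothing to count; hence two elements can
  -- only be compared at finitely many ranks.
  refine ⟨(K.typ C).sup Prod.snd, fun l hl x => ?_⟩
  classical
  rw [satCount, Finset.card_eq_zero, Finset.filter_eq_empty_iff]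
  rintro p hp ⟨rfl, -⟩
  exact absurd (Finset.le_sup (f := Prod.snd) hp) (not_le.mpr hl)

theorem rankLE_iff (x y : Δ) :
    rankLE K I C x y ↔ (fun l => satCount K I C l x) = (fun l => satCount K I C l y) ∨
      LexAbove (fun l => satCount K I C l x) (fun l => satCount K I C l y) := by
  rw [funext_iff]
  exact Iff.rfl

theorem satCount_trichotomy (x y : Δ) :
    (fun l => satCount K I C l x) = (fun l => satCount K I C l y) ∨
      LexAbove (fun l => satCount K I C l x) (fun l => satCount K I C l y) ∨
      LexAbove (fun l => satCount K I C l y) (fun l => satCount K I C l x) := by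
  obtain ⟨N, hN⟩ := exists_satCount_eq_zero K I C
  exact LexAbove.trichotomy (N := N) fun l hl => (hN l hl x).trans (hN l hl y).symm

theorem rankLT_iff (x y : Δ) :
    rankLT K I C x y ↔
      LexAbove (fun l => satCount K I C l x) (fun l => satCount K I C l y) := by
  rw [rankLT, rankLE_iff, rankLE_iff]
  constructor
  · rintro ⟨h | h, h'⟩
    exacts [absurd (Or.inl h.symm) h', h]
  · refine fun h => ⟨Or.inr h, ?_⟩
    rintro (h' | h')
    · rw [h'] at h
      exact LexAbove.irrefl _ h
    · exact LexAbove.irrefl _ (h.trans h')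

theorem rankLT_irrefl (x : Δ) : ¬ rankLT K I C x x := fun h => h.2 h.1

variable {K I C}

theorem rankLT_trans {x y z : Δ} : rankLT K I C x y → rankLT K I C y z → rankLT K I C x z := by
  simp only [rankLT_iff]
  exact LexAbove.trans

theorem rankLT_modular {x y : Δ} (z : Δ) :
    rankLT K I C x y → rankLT K I C x z ∨ rankLT K I C z y := by
  simp only [rankLT_iff]
  intro h
  rcases satCount_trichotomy K I C x z with e | e | e
  · exact Or.inr (e ▸ h)
  · exact Or.inl e
  · exact Or.inr (e.trans h)

end Rank

/-- The cw^m-interpretation over a finite interpretation whose preferences are those induced by the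
ranked TBoxes. -/
def Interp.toCwm {NC NR NI Δ : Type u} [Nonempty Δ] [Finite Δ] (K : RankedKB NC NR NI)
    (I : Interp NC NR NI Δ) : CwmInterp K where
  Dom := Δ
  nonempty := inferInstance
  finite := inferInstance
  I := I
  lt C := rankLT K I C.1
  lt_irrefl C := rankLT_irrefl K I C.1
  lt_trans _ _ _ _ := rankLT_trans
  lt_wf C :=
    haveI : IsTrans Δ (rankLT K I C.1) := ⟨fun _ _ _ => rankLT_trans⟩
    haveI : Std.Irrefl (rankLT K I C.1) := ⟨rankLT_irrefl K I C.1⟩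
    Finite.wellFounded_of_trans_of_irrefl _
  lt_modular _ _ _ z := rankLT_modular z
  glt x y := (∃ C : {C // C ∈ K.dist}, rankLT K I C.1 x y) ∧
    ∀ C : {C // C ∈ K.dist}, ¬ rankLT K I C.1 y x ∨
      ∃ C' : {C // C ∈ K.dist}, K.MoreSpecific C'.1 C.1 ∧ rankLT K I C'.1 x y
  glt_iff _ _ := Iff.rfl

/-! ### From answer sets to models -/

section Canonical

variable {NC NR NI : Type u}

/-- The individual names of an assertion. -/
def Assertion.inds : Assertion NC NR NI → Set NI
  | .inst _ a => {a}
  | .rel _ a b => {a, b}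

theorem Assertion.finite_inds (α : Assertion NC NR NI) : α.inds.Finite := by
  cases α <;> simp [Assertion.inds]

/-- The constants that represent domain elements and come from `K` or the query `C`. -/
inductive IsRelevant (K : RankedKB NC NR NI) (C : NC) : Const NC NR NI → Prop
  | query : IsRelevant K C (.aux C)
  | aux {A : NC} (hA : Concept.name A ∈ K.dist) : IsRelevant K C (.aux A)
  | auxEx {A : NC} {R : NR} {B : NC}
      (h : Inclusion.sub (.name A) (.ex R (.name B)) ∈ K.strict) : IsRelevant K C (.auxEx A R B)
  | ind {a : NI} {α : Assertion NC NR NI} (hα : α ∈ K.abox) (ha : a ∈ α.inds) :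
      IsRelevant K C (.ind a)

/-- The name types may be infinite and every individual is a nominal, so relevance is what keeps the
canonical domain finite. -/
theorem finite_isRelevant (K : RankedKB NC NR NI) (C : NC) :
    {x | IsRelevant K C x}.Finite := by
  have h₁ : (Const.aux '' (Concept.name ⁻¹' (K.dist : Set (Concept NC NR))) :
      Set (Const NC NR NI)).Finite :=
    (K.dist.finite_toSet.preimage fun _ _ _ _ h => Concept.name.inj h).image _
  have h₂ : ((fun p : NC × NR × NC => (Const.auxEx p.1 p.2.1 p.2.2 : Const NC NR NI)) ''
      ((fun p : NC × NR × NC => Inclusion.sub (.name p.1) (.ex p.2.1 (.name p.2.2))) ⁻¹'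
        (K.strict : Set (Inclusion NC NR)))).Finite := by
    refine (K.strict.finite_toSet.preimage ?_).image _
    rintro ⟨A, R, B⟩ - ⟨A', R', B'⟩ - h
    simpa using h
  have h₃ : (Const.ind '' (⋃ α ∈ (K.abox : Set (Assertion NC NR NI)), α.inds) :
      Set (Const NC NR NI)).Finite :=
    (K.abox.finite_toSet.biUnion fun α _ => α.finite_inds).image _
  refine ((Set.finite_singleton (Const.aux C)).union (h₁.union (h₂.union h₃))).subset ?_
  rintro x (_ | hA | h | ⟨hα, ha⟩)
  · exact Or.inl rfl
  · exact Or.inr (Or.inl ⟨_, hA, rfl⟩)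
  · exact Or.inr (Or.inr (Or.inl ⟨(_, _, _), h, rfl⟩))
  · exact Or.inr (Or.inr (Or.inr ⟨_, Set.mem_biUnion hα ha, rfl⟩))

variable {K : RankedKB NC NR NI} {C : NC} {S : Set (GAtom (Const NC NR NI))}

theorem fact_mem_of_satisfied (hS : ∀ r ∈ program K C, r.Satisfied S)
    {f : GAtom (Const NC NR NI)} (hf : Fact K C f) : f ∈ S :=
  hS _ (InProgram.fact hf) (by simp) (by simp)

theorem head_mem_of_satisfied (hS : ∀ r ∈ program K C, r.Satisfied S)
    {a : GAtom (Const NC NR NI)} {body : List (GAtom (Const NC NR NI))}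
    (h : DefRule a body) (hb : ∀ b ∈ body, b ∈ S) : a ∈ S :=
  hS _ (InProgram.defRule h) hb (by simp)

variable (K C S) in
/-- The domain of the canonical model: the relevant constants that are instances of something. -/
abbrev CanonicalDom : Type u :=
  {x : Const NC NR NI // (∃ y, GAtom.inst x y ∈ S) ∧ IsRelevant K C x}

open Classical in
variable (K C S) in
/-- The canonical interpretation; individual names outside of the ABox are sent to `d`. -/
noncomputable def canonical (d : CanonicalDom K C S) :
    Interp NC NR NI (CanonicalDom K C S) where
  conc A := {x | GAtom.inst x.1 (.cls A) ∈ S}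
  role R x y := GAtom.triple x.1 (.rol R) y.1 ∈ S
  ind a := if h : (∃ y, GAtom.inst (.ind a) y ∈ S) ∧ IsRelevant K C (.ind a) then ⟨.ind a, h⟩
    else d

theorem inst_ind_self (hS : ∀ r ∈ program K C, r.Satisfied S) (a : NI) :
    GAtom.inst (.ind a) (.ind a) ∈ S :=
  head_mem_of_satisfied hS (.r1 _) (by simpa using fact_mem_of_satisfied hS (.nom a))

theorem canonical_ind (hS : ∀ r ∈ program K C, r.Satisfied S) (d : CanonicalDom K C S) {a : NI}
    {α : Assertion NC NR NI} (hα : α ∈ K.abox) (ha : a ∈ α.inds) :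
    ((canonical K C S d).ind a).1 = .ind a := by
  simp only [canonical]
  rw [dif_pos ⟨⟨_, inst_ind_self hS a⟩, IsRelevant.ind hα ha⟩]

/-! ### The canonical interpretation is a T-compliant model -/

theorem canonical_satStrict (hK : K.IsNormal) (hS : ∀ r ∈ program K C, r.Satisfied S)
    (d : CanonicalDom K C S) : (canonical K C S d).SatStrict K := by
  intro α hα
  have hn := hK.strict α hα
  have fact {f} (hf : InclFact α f) : f ∈ S := fact_mem_of_satisfied hS (.incl hα hf)
  cases hn with
  | top B =>
    -- The rule for top fires only on constants that are already instances of something; membership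
    -- in the domain supplies such a `y`.
    rintro ⟨x, ⟨y, hy⟩, hx⟩ -
    exact head_mem_of_satisfied hS (.r3 _ _ y) (by simpa using ⟨fact (.top B), hy⟩)
  | bot A =>
    intro x hx
    exact hS _ (InProgram.bot (.cls A) x.1) (by simpa using ⟨fact (.bot A), hx⟩) (by simp)
  | sub A B =>
    intro x hx
    exact head_mem_of_satisfied hS (.r5 _ (.cls A) _) (by simpa using ⟨fact (.sub A B), hx⟩)
  | conj A B D =>
    rintro x ⟨hx, hx'⟩
    exact head_mem_of_satisfied hS (.r6 _ (.cls A) (.cls B) _)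
      (by simpa using ⟨fact (.conj A B D), hx, hx'⟩)
  | exL R A B =>
    rintro x ⟨y, hxy, hy⟩
    exact head_mem_of_satisfied hS (.r7 _ y.1 (.rol R) (.cls A) _)
      (by simpa using ⟨fact (.exL R A B), hxy, hy⟩)
  | exR A R B =>
    intro x hx
    have hb : ∀ b ∈ [GAtom.supEx (.cls A) (.rol R) (.cls B) (.auxEx A R B),
        GAtom.inst x.1 (.cls A)], b ∈ S := by
      simpa using ⟨fact (.exR A R B), hx⟩
    have hi := head_mem_of_satisfied hS (.r10 _ _ _ _ _) hb
    -- One auxiliary constant serves as the successor of all instances of `A`; the derived atom `hi`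
    -- also puts it into the domain.
    exact ⟨⟨.auxEx A R B, ⟨_, hi⟩, .auxEx hα⟩, head_mem_of_satisfied hS (.r9 _ _ _ _ _) hb, hi⟩
  | role R T =>
    intro x y hxy
    exact head_mem_of_satisfied hS (.r13 _ _ (.rol R) _) (by simpa using ⟨fact (.role R T), hxy⟩)
  | chain R R' T =>
    rintro x z ⟨y, hxy, hyz⟩
    exact head_mem_of_satisfied hS (.r15 _ y.1 _ (.rol R) (.rol R') _)
      (by simpa using ⟨fact (.chain R R' T), hxy, hyz⟩)

theorem canonical_satABox (hK : K.IsNormal) (hS : ∀ r ∈ program K C, r.Satisfied S)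
    (d : CanonicalDom K C S) : (canonical K C S d).SatABox K := by
  intro α hα
  have hn := hK.abox α hα
  have fact {f} (hf : AssertFact α f) : f ∈ S := fact_mem_of_satisfied hS (.assertion hα hf)
  cases hn with
  | inst A a =>
    change GAtom.inst ((canonical K C S d).ind a).1 (.cls A) ∈ S
    rw [canonical_ind hS d hα (by simp [Assertion.inds])]
    exact head_mem_of_satisfied hS (.r5 _ (.ind a) _)
      (by simpa using ⟨fact (.inst A a), inst_ind_self hS a⟩)
  | rel R a b =>
    change GAtom.triple ((canonical K C S d).ind a).1 (.rol R) ((canonical K C S d).ind b).1 ∈ S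
    rw [canonical_ind hS d hα (by simp [Assertion.inds]),
      canonical_ind hS d hα (by simp [Assertion.inds])]
    exact head_mem_of_satisfied hS (.r9 _ _ _ (.ind a) (.ind b))
      (by simpa using ⟨fact (.rel R a b), inst_ind_self hS a⟩)

theorem canonical_tCompliant (hK : K.IsNormal) (hS : ∀ r ∈ program K C, r.Satisfied S)
    (d : CanonicalDom K C S) : (canonical K C S d).TCompliant K := by
  refine ⟨canonical_satStrict hK hS d, fun E hE => ?_⟩
  obtain ⟨A, rfl⟩ := hK.dist E hE
  rintro ⟨x, hx⟩
  have hauxtc := fact_mem_of_satisfied hS (.auxtc hE)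
  -- Rule (b): one instance `x` of `A` suffices to make the auxiliary constant an instance, and this
  -- constant is the typical witness.
  have hinst : GAtom.inst (.aux A) (.cls A) ∈ S :=
    head_mem_of_satisfied hS (.rb _ _ x.1) (by simpa using ⟨hauxtc, hx⟩)
  have htyp : GAtom.typ (.aux A) (.cls A) ∈ S :=
    head_mem_of_satisfied hS (.rc _ _) (by simpa using ⟨hauxtc, hinst⟩)
  refine ⟨⟨.aux A, ⟨_, hinst⟩, .aux hE⟩, hinst, ?_⟩
  rintro ⟨F, n⟩ hp
  obtain ⟨B, rfl⟩ : ∃ B, F = .name B := hK.typ _ hE _ hp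
  exact Or.inr (head_mem_of_satisfied hS (.rd _ (.cls A) _ (.rank n))
    (by simpa using ⟨fact_mem_of_satisfied hS (.subTyp hE hp), htyp⟩))

theorem exists_model_of_satisfied (hK : K.IsNormal) (hS : ∀ r ∈ program K C, r.Satisfied S)
    {D : NC} (hD : GAtom.inst (.aux C) (.cls D) ∉ S) :
    ∃ M : CwmInterp K, M.IsModel ∧ M.I.TCompliant K ∧
      ¬ M.I.SatIncl (.sub (.name C) (.name D)) := by
  have hC := fact_mem_of_satisfied hS (.queryInst)
  let d : CanonicalDom K C S := ⟨.aux C, ⟨_, hC⟩, .query⟩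
  have : Nonempty (CanonicalDom K C S) := ⟨d⟩
  have : Finite (CanonicalDom K C S) :=
    ((finite_isRelevant K C).subset fun _ hx => hx.2).to_subtype
  exact ⟨(canonical K C S d).toCwm K,
    ⟨fun _ _ _ => Iff.rfl, canonical_satStrict hK hS d, canonical_satABox hK hS d⟩,
    canonical_tCompliant hK hS d, fun h => hD (@h d hC)⟩

end Canonical

/-! ### From models to answer sets -/

section Soundness

variable {NC NR NI Δ : Type u}

/-! ### The choice-free answer set -/

/-- The atoms derivable from the facts by the definite rules of the program alone. -/
inductive Derivable (K : RankedKB NC NR NI) (C : NC) : GAtom (Const NC NR NI) → Prop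
  | fact {f : GAtom (Const NC NR NI)} (hf : Fact K C f) : Derivable K C f
  | rule {a : GAtom (Const NC NR NI)} {body : List (GAtom (Const NC NR NI))}
      (h : DefRule a body) (hb : ∀ b ∈ body, Derivable K C b) : Derivable K C a

/-- The answer set of the program in which no choice rule is applied. -/
def choiceFreeAnswerSet (K : RankedKB NC NR NI) (C : NC) : Set (GAtom (Const NC NR NI)) :=
  {a | Derivable K C a ∨ ∃ c d, a = .morespec c d ∧ Derivable K C (.dcls c) ∧
    Derivable K C (.dcls d) ∧ Derivable K C (.instSc c d c) ∧ ¬ Derivable K C (.instSc d c d)}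

/-- This is the stratification of the program: adding `morespec` atoms to the definite closure
triggers no further definite rule. -/
theorem DefRule.ne_morespec {κ : Type u} {a : GAtom κ} {body : List (GAtom κ)}
    (h : DefRule a body) {b : GAtom κ} (hb : b ∈ body) (c d : κ) : b ≠ .morespec c d := by
  rintro rfl
  cases h <;> simp at hb

theorem mem_choiceFreeAnswerSet_iff {K : RankedKB NC NR NI} {C : NC} {a : GAtom (Const NC NR NI)}
    (ha : ∀ c d, a ≠ .morespec c d) : a ∈ choiceFreeAnswerSet K C ↔ Derivable K C a :=
  ⟨fun h => h.resolve_right fun ⟨c, d, e, _⟩ => ha c d e, Or.inl⟩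

theorem isAnswerSet_choiceFreeAnswerSet {K : RankedKB NC NR NI} {C : NC}
    (hbot : ∀ z x, Derivable K C (.bot z) → ¬ Derivable K C (.inst x z)) :
    IsAnswerSet (program K C) (choiceFreeAnswerSet K C) := by
  have hsat : ∀ r ∈ program K C, r.Satisfied (choiceFreeAnswerSet K C) := by
    intro r hr hpos hneg
    cases hr with
    | fact hf => exact Or.inl (.fact hf)
    | defRule h =>
      exact Or.inl (.rule h fun b hb =>
        (mem_choiceFreeAnswerSet_iff (h.ne_morespec hb)).mp (hpos b hb))
    | bot z x =>
      exact hbot z x ((mem_choiceFreeAnswerSet_iff (by simp)).mp (hpos _ (by simp)))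
        ((mem_choiceFreeAnswerSet_iff (by simp)).mp (hpos _ (by simp)))
    | morespec c d =>
      exact Or.inr ⟨c, d, rfl, (mem_choiceFreeAnswerSet_iff (by simp)).mp (hpos _ (by simp)),
        (mem_choiceFreeAnswerSet_iff (by simp)).mp (hpos _ (by simp)),
        (mem_choiceFreeAnswerSet_iff (by simp)).mp (hpos _ (by simp)),
        fun h => hneg _ (by simp) (Or.inl h)⟩
    | choice c d => trivial
  refine ⟨hsat, ?_, ?_⟩
  -- A choice rule survives in the reduct only if its head is already in the set, so closure is
  -- automatic for it.
  · rintro ⟨a, body⟩ ⟨r, hr, hneg, rfl, hhead⟩ hpos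
    rcases hhead with hhead | hhead
    · simpa only [hhead, Head.Holds] using hsat r hr hpos hneg
    · exact hhead.2
  · intro T hT a ha
    have key : ∀ b, Derivable K C b → b ∈ T := by
      intro b hb
      induction hb with
      | @fact f hf => exact hT (f, []) ⟨_, InProgram.fact hf, by simp, rfl, Or.inl rfl⟩ (by simp)
      | @rule a body h _ ih =>
        exact hT (a, body) ⟨_, InProgram.defRule h, by simp, rfl, Or.inl rfl⟩ ih
    rcases ha with ha | ⟨c, d, rfl, h₁, h₂, h₃, h₄⟩
    · exact key a ha
    · refine hT (.morespec c d, [.dcls c, .dcls d, .instSc c d c])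
        ⟨_, InProgram.morespec c d, ?_, rfl, Or.inl rfl⟩ ?_
      -- The rule for `morespec` stays in the reduct because membership of an `instSc` atom in the
      -- candidate is the same as its derivability.
      · simpa using fun h => h₄ ((mem_choiceFreeAnswerSet_iff (by simp)).mp h)
      · simpa using ⟨key _ h₁, key _ h₂, key _ h₃⟩

/-! ### Semantic reading of constants and atoms -/

/-- The elements of `I` represented by a constant, where the query `C` is represented by `e`. -/
def Const.repr (K : RankedKB NC NR NI) (I : Interp NC NR NI Δ) (C : NC) (e : Δ) :
    Const NC NR NI → Set Δ
  | .ind a => {I.ind a}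
  | .cls A => I.conc A
  | .rol _ => ∅
  | .rank _ => ∅
  | .auxEx A R B => {y | y ∈ I.conc B ∧ ∃ x ∈ I.conc A, I.role R x y}
  | .aux A => {x | (A = C ∧ x = e) ∨
      (A ≠ C ∧ x ∈ I.conc A ∧ ∀ p ∈ K.typ (.name A), I.SatTyp (.name A) p.1 x)}

/-- The semantic reading of the atoms for instance checking. -/
def GAtom.Sound (K : RankedKB NC NR NI) (I : Interp NC NR NI Δ) (C : NC) (e : Δ) :
    GAtom (Const NC NR NI) → Prop
  | .inst x y => (x.repr K I C e).Nonempty ∧ x.repr K I C e ⊆ y.repr K I C e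
  | .triple x v y => (x.repr K I C e).Nonempty ∧ ∃ R, v = .rol R ∧
      ∀ d ∈ x.repr K I C e, ∃ d' ∈ y.repr K I C e, I.role R d d'
  | .typ y c => Fact K C (.auxtc y c) ∧ (y.repr K I C e).Nonempty
  | .instSc .. => True
  | .tripleSc .. => True
  | .morespec .. => True
  | .dcls .. => True
  | .tprop .. => True
  | .validrank .. => True
  | a => Fact K C a

variable {K : RankedKB NC NR NI} {I : Interp NC NR NI Δ} {C : NC} {e : Δ}

/-- Among the auxiliary constants only that of the query is a nominal; the others may stand for many
elements. -/
theorem repr_nom {y : Const NC NR NI} (h : Fact K C (.nom y)) :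
    ∃ d, y.repr K I C e = {d} := by
  cases h with
  | nom a => exact ⟨_, rfl⟩
  | queryNom => exact ⟨e, by ext; simp [Const.repr]⟩
  | incl _ hf => cases hf
  | assertion _ hf => cases hf

theorem subset_of_subset_nom {x y : Const NC NR NI} {s : Set Δ} (hy : Fact K C (.nom y))
    (hx : (x.repr K I C e).Nonempty) (hxy : x.repr K I C e ⊆ y.repr K I C e)
    (hs : x.repr K I C e ⊆ s) : (y.repr K I C e).Nonempty ∧ y.repr K I C e ⊆ s := by
  obtain ⟨d, hd⟩ := repr_nom (I := I) (e := e) hy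
  -- A non-empty subset of the singleton `y` is all of `y`, so whatever contains `x` contains `y`.
  obtain ⟨d', hd'⟩ := hx
  obtain rfl : d' = d := by simpa [hd] using hxy hd'
  rw [hd]
  exact ⟨⟨_, rfl⟩, by simpa using hs hd'⟩

theorem sound_fact (he : e ∈ I.conc C) {f : GAtom (Const NC NR NI)}
    (hf : Fact K C f) : f.Sound K I C e := by
  cases hf with
  | queryInst =>
    refine ⟨⟨e, Or.inl ⟨rfl, rfl⟩⟩, ?_⟩
    rintro x (⟨-, rfl⟩ | ⟨h, -⟩)
    exacts [he, absurd rfl h]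
  | incl hα h => cases h <;> exact .incl hα (by constructor)
  | assertion hα h => cases h <;> exact .assertion hα (by constructor)
  | nom a => exact .nom a
  | cls a => exact .cls a
  | rol a => exact .rol a
  | subTyp hA hB => exact .subTyp hA hB
  | auxtc hA => exact .auxtc hA
  | queryAuxtc => exact .queryAuxtc
  | queryNom => exact .queryNom

theorem repr_top (hI : I.SatStrict K) {z : Const NC NR NI} (h : Fact K C (.top z)) :
    z.repr K I C e = Set.univ := by
  cases h with
  | incl hα hf => cases hf; exact Set.univ_subset_iff.mp (hI _ hα)
  | assertion _ hf => cases hf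

theorem repr_bot (hI : I.SatStrict K) {z : Const NC NR NI} (h : Fact K C (.bot z)) :
    z.repr K I C e = ∅ := by
  cases h with
  | incl hα hf => cases hf; exact Set.subset_empty_iff.mp (hI _ hα)
  | assertion _ hf => cases hf

theorem repr_subClass (hI : I.SatStrict K) (hA : I.SatABox K) {y z : Const NC NR NI}
    (h : Fact K C (.subClass y z)) : y.repr K I C e ⊆ z.repr K I C e := by
  cases h with
  | incl hα hf => cases hf; exact hI _ hα
  | assertion hα hf => cases hf; exact Set.singleton_subset_iff.mpr (hA _ hα)

theorem repr_subConj (hI : I.SatStrict K) {y y' z : Const NC NR NI}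
    (h : Fact K C (.subConj y y' z)) :
    y.repr K I C e ∩ y'.repr K I C e ⊆ z.repr K I C e := by
  cases h with
  | incl hα hf => cases hf; exact hI _ hα
  | assertion hα hf => cases hf

theorem repr_subEx (hI : I.SatStrict K) {R : NR} {y z : Const NC NR NI}
    (h : Fact K C (.subEx (.rol R) y z)) {d d' : Δ} (hd : I.role R d d')
    (hd' : d' ∈ y.repr K I C e) : d ∈ z.repr K I C e := by
  cases h with
  | incl hα hf => cases hf; exact hI _ hα ⟨d', hd, hd'⟩
  | assertion hα hf => cases hf

/-- The auxiliary constant stands for all elements of `B` that are `R`-successors of an element of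
`A`, so no successor has to be chosen. For an assertion `R(a,b)` both sides are singletons. -/
theorem repr_supEx (hI : I.SatStrict K) (hA : I.SatABox K) {y v z x : Const NC NR NI}
    (h : Fact K C (.supEx y v z x)) :
    x.repr K I C e ⊆ z.repr K I C e ∧ ∃ R, v = .rol R ∧
      ∀ d ∈ y.repr K I C e, ∃ d' ∈ x.repr K I C e, I.role R d d' := by
  cases h with
  | incl hα hf =>
    cases hf
    refine ⟨fun d hd => hd.1, _, rfl, fun d hd => ?_⟩
    obtain ⟨d', hr, hd'⟩ := hI _ hα hd
    exact ⟨d', ⟨hd', d, hd, hr⟩, hr⟩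
  | assertion hα hf =>
    cases hf
    refine ⟨subset_rfl, _, rfl, ?_⟩
    rintro d rfl
    exact ⟨_, rfl, hA _ hα⟩

theorem role_subRole (hI : I.SatStrict K) {R : NR} {w : Const NC NR NI}
    (h : Fact K C (.subRole (.rol R) w)) :
    ∃ T, w = .rol T ∧ ∀ d d', I.role R d d' → I.role T d d' := by
  cases h with
  | incl hα hf => cases hf; exact ⟨_, rfl, hI _ hα⟩
  | assertion hα hf => cases hf

theorem role_subRChain (hI : I.SatStrict K) {R R' : NR} {w : Const NC NR NI}
    (h : Fact K C (.subRChain (.rol R) (.rol R') w)) :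
    ∃ T, w = .rol T ∧ ∀ d d' d'', I.role R d d' → I.role R' d' d'' → I.role T d d'' := by
  cases h with
  | incl hα hf =>
    cases hf
    exact ⟨_, rfl, fun d d' d'' h h' => hI _ hα d d'' ⟨d', h, h'⟩⟩
  | assertion hα hf => cases hf

/-- T-compliance is what keeps the set of typical elements of a non-empty distinguished concept
non-empty. As `C` is not distinguished, its auxiliary constant can be reserved for `e`. -/
theorem repr_auxtc (hT : I.TCompliant K) (hC : Concept.name C ∉ K.dist) (he : e ∈ I.conc C)
    {y c : Const NC NR NI} (h : Fact K C (.auxtc y c)) (hc : (c.repr K I C e).Nonempty) :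
    (y.repr K I C e).Nonempty ∧ y.repr K I C e ⊆ c.repr K I C e := by
  cases h with
  | @auxtc A hA =>
    obtain ⟨x, hx, hx'⟩ := hT.2 _ hA hc
    have hne : A ≠ C := by rintro rfl; exact hC hA
    refine ⟨⟨x, Or.inr ⟨hne, hx, hx'⟩⟩, ?_⟩
    rintro d (⟨h, -⟩ | ⟨-, h, -⟩)
    exacts [absurd h hne, h]
  | queryAuxtc =>
    refine ⟨⟨e, Or.inl ⟨rfl, rfl⟩⟩, ?_⟩
    rintro x (⟨-, rfl⟩ | ⟨h, -⟩)
    exacts [he, absurd rfl h]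
  | incl hα hf => cases hf
  | assertion hα hf => cases hf

/-- The element `e` need not be typical: if `C` were distinguished, rule (d) would force the typical
properties of `C` on it. -/
theorem repr_subTyp (hC : Concept.name C ∉ K.dist) {y c d n : Const NC NR NI}
    (h : Fact K C (.auxtc y c)) (h' : Fact K C (.subTyp c d n)) :
    y.repr K I C e ⊆ d.repr K I C e := by
  cases h' with
  | @subTyp A B n hA hB =>
    have hne : A ≠ C := by rintro rfl; exact hC hA
    cases h with
    | auxtc _ =>
      rintro x (⟨h, -⟩ | ⟨-, hx, hx'⟩)
      · exact absurd h hne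
      · exact (hx' _ hB).resolve_left fun h => h hx
    | queryAuxtc => exact absurd rfl hne
    | incl hα hf => cases hf
    | assertion hα hf => cases hf
  | incl hα hf => cases hf
  | assertion hα hf => cases hf

/-! ### Soundness of derivations -/

theorem sound_defRule (hT : I.TCompliant K) (hA : I.SatABox K) (hC : Concept.name C ∉ K.dist)
    (he : e ∈ I.conc C) {a : GAtom (Const NC NR NI)} {body : List (GAtom (Const NC NR NI))}
    (h : DefRule a body) (hb : ∀ b ∈ body, b.Sound K I C e) : a.Sound K I C e := by
  have hI := hT.1
  cases h <;> simp only [List.forall_mem_cons, List.not_mem_nil, false_imp_iff, implies_true,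
    -- This closes the rules whose head is read as `True`: subclass checking and the bookkeeping
    -- predicates.
    and_true] at hb <;> try trivial
  case r1 x =>
    obtain ⟨d, hd⟩ := repr_nom (I := I) (e := e) hb
    exact ⟨⟨d, by simp [hd]⟩, subset_rfl⟩
  case r3 x z z' =>
    exact ⟨hb.2.1, by rw [repr_top hI hb.1]; exact Set.subset_univ _⟩
  case r4 x y z u z' =>
    -- The rule for bottom never fires: `u` would be a non-empty subset of an empty class.
    obtain ⟨hz, ⟨⟨d, hd⟩, hu⟩, -⟩ := hb
    rw [repr_bot hI hz] at hu
    exact absurd (hu hd) (Set.notMem_empty d)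
  case r5 x y z =>
    exact ⟨hb.2.1, hb.2.2.trans (repr_subClass hI hA hb.1)⟩
  case r6 x y y' z =>
    exact ⟨hb.2.1.1, (Set.subset_inter hb.2.1.2 hb.2.2.2).trans (repr_subConj hI hb.1)⟩
  case r7 x x' v y z =>
    obtain ⟨hf, ⟨hx, R, rfl, hR⟩, -, hx'⟩ := hb
    refine ⟨hx, fun d hd => ?_⟩
    obtain ⟨d', hd', hr⟩ := hR d hd
    exact repr_subEx hI hf hr (hx' hd')
  case r9 x x' v y z =>
    obtain ⟨hf, hx, hxy⟩ := hb
    obtain ⟨-, R, rfl, hR⟩ := repr_supEx (e := e) hI hA hf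
    exact ⟨hx, R, rfl, fun d hd => hR d (hxy hd)⟩
  case r10 x x' v y z =>
    obtain ⟨hf, ⟨d, hd⟩, hxy⟩ := hb
    obtain ⟨hz, R, rfl, hR⟩ := repr_supEx (e := e) hI hA hf
    obtain ⟨d', hd', -⟩ := hR d (hxy hd)
    exact ⟨⟨d', hd'⟩, hz⟩
  case r13 x x' v w =>
    obtain ⟨hf, hx, R, rfl, hR⟩ := hb
    obtain ⟨T, rfl, hRT⟩ := role_subRole hI hf
    refine ⟨hx, T, rfl, fun d hd => ?_⟩
    obtain ⟨d', hd', hr⟩ := hR d hd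
    exact ⟨d', hd', hRT _ _ hr⟩
  case r15 x x' x'' u v w =>
    obtain ⟨hf, ⟨hx, R, rfl, hR⟩, -, R', rfl, hR'⟩ := hb
    obtain ⟨T, rfl, hRT⟩ := role_subRChain hI hf
    refine ⟨hx, T, rfl, fun d hd => ?_⟩
    obtain ⟨d', hd', hr⟩ := hR d hd
    obtain ⟨d'', hd'', hr'⟩ := hR' d' hd'
    exact ⟨d'', hd'', hRT _ _ _ hr hr'⟩
  case r27 x y z =>
    exact subset_of_subset_nom hb.2.1 hb.1.1 hb.1.2 hb.2.2.2
  case r28 x y z =>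
    exact ⟨hb.1.1, hb.1.2.trans hb.2.2.2⟩
  case r29 x y z u =>
    obtain ⟨⟨-, hxy⟩, -, hz, R, rfl, hR⟩ := hb
    refine ⟨hz, R, rfl, fun d hd => ?_⟩
    obtain ⟨d', hd', hr⟩ := hR d hd
    exact ⟨d', hxy hd', hr⟩
  case rb y c x =>
    exact repr_auxtc hT hC he hb.1 (hb.2.1.mono hb.2.2)
  case rc y c =>
    exact ⟨hb.1, hb.2.1⟩
  case rd y c d n =>
    exact ⟨hb.2.2, repr_subTyp hC hb.2.1 hb.1⟩

theorem Derivable.sound (hT : I.TCompliant K) (hA : I.SatABox K) (hC : Concept.name C ∉ K.dist)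
    (he : e ∈ I.conc C) {a : GAtom (Const NC NR NI)} (h : Derivable K C a) :
    a.Sound K I C e := by
  induction h with
  | fact hf => exact sound_fact he hf
  | rule h _ ih => exact sound_defRule hT hA hC he h ih

theorem exists_isAnswerSet_of_interp (hT : I.TCompliant K) (hA : I.SatABox K)
    (hC : Concept.name C ∉ K.dist) {D : NC} (hCD : ¬ I.SatIncl (.sub (.name C) (.name D))) :
    ∃ S, IsAnswerSet (program K C) S ∧
      (GAtom.inst (.aux C) (.cls D) : GAtom (Const NC NR NI)) ∉ S := by
  obtain ⟨e, he, heD⟩ := Set.not_subset.mp hCD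
  have hs {a : GAtom (Const NC NR NI)} (h : Derivable K C a) := h.sound hT hA hC he
  -- Both goals follow from soundness: a violated constraint would put an element into an empty
  -- class, and the queried atom would put `e` into `D`.
  refine ⟨_, isAnswerSet_choiceFreeAnswerSet fun z x hz hx => ?_, fun h => ?_⟩
  · obtain ⟨⟨d, hd⟩, hsub⟩ := hs hx
    rw [repr_bot hT.1 (hs hz)] at hsub
    exact hsub hd
  · exact heD ((hs ((mem_choiceFreeAnswerSet_iff (by simp)).mp h)).2 (Or.inl ⟨rfl, rfl⟩))

end Soundness

end CWM

theorem proposition2 {NC NR NI : Type u} (K : CWM.RankedKB NC NR NI) (hK : K.IsNormal)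
    (C D : NC) :
    ((∃ S : Set (CWM.GAtom (CWM.Const NC NR NI)),
        CWM.IsAnswerSet (CWM.program K C) S ∧ CWM.GAtom.inst (.aux C) (.cls D) ∉ S) →
      ∃ M : CWM.CwmInterp K, M.IsModel ∧ M.I.TCompliant K ∧
        ¬ M.I.SatIncl (.sub (.name C) (.name D))) ∧
    (CWM.Concept.name C ∉ K.dist →
      (∃ M : CWM.CwmInterp K, M.IsModel ∧ M.I.TCompliant K ∧
        ¬ M.I.SatIncl (.sub (.name C) (.name D))) →
      ∃ S : Set (CWM.GAtom (CWM.Const NC NR NI)),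
        CWM.IsAnswerSet (CWM.program K C) S ∧
          CWM.GAtom.inst (.aux C) (.cls D) ∉ S) := by
  exact ⟨fun ⟨_, hS, hD⟩ => CWM.exists_model_of_satisfied hK hS.1 hD,
    fun hC ⟨_, hM, hT, hCD⟩ => CWM.exists_isAnswerSet_of_interp hT hM.abox hC hCD⟩
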